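/- Let $V$ be a vertex operator algebra over $\mathbb{C}$ ($\mathbb{Z}$-graded by $L(0)$-eigenvalues, with finite-dimensional weight spaces that vanish for sufficiently negative weights), with vacuum $\mathbf 1$, conformal vector $\omega$, $Y(u,x)=\sum_{j\in\mathbb Z}u_jx^{-j-1}$ and $L(m)=\omega_{m+1}$. For $n\in\mathbb{N}$ let $O_n(V)$ be the subspace of $V$ spanned by all $(L(-1)+L(0))v$, $v\in V$, and all $$\mathrm{Res}_x\frac{(1+x)^{\mathrm{wt}\,u+n}Y(u,x)v}{x^{2n+2}},\qquad u\in V\text{ homogeneous},\ v\in V;$$ write $a\equiv_n b$ for $a-b\in O_n(V)$, and let $$u*_nv=\sum_{m=0}^n(-1)^m\binom{m+n}{n}\mathrm{Res}_x\frac{(1+x)^{\mathrm{wt}\,u+n}Y(u,x)v}{x^{n+m+1}}$$ for homogeneous $u$ and $v\in V$, extended linearly in $u$. Here $\binom{a}{m}$, for $a\in\mathbb Z$ and $m\in\mathbb{N}$, is the generalized binomial coefficient $a(a-1)\cdots(a-m+1)/m!$. Fix $n\ge 1$ and let $u\in V$ be homogeneous of weight $\mathrm{wt}\,u\ge -n$.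 Suppose that the vertex subalgebra of $V$ generated by $u$, i.e. the span of all $u_{k_1}\cdots u_{k_r}\mathbf 1$ with $r\ge 0$ and $k_1,\dots,k_r\in\mathbb Z$, is already spanned by those of these vectors with $k_1,\dots,k_r\le -1$, and that $u$ has the permutation property: for all $m\ge 1$, all $k_1,\dots,k_m\in\mathbb Z$ and all permutations $\sigma$ of $\{1,\dots,m\}$, $$u_{-k_1}\cdots u_{-k_m}\mathbf 1-u_{-k_{\sigma(1)}}\cdots u_{-k_{\sigma(m)}}\mathbf 1\in F_{m-1}(\mathbf 1),$$ where $F_r(\mathbf 1)$ is the span of all $u_{-l_1}\cdots u_{-l_s}\mathbf 1$ with $0\le s\le r$ and $l_1,\dots,l_s\ge 1$. Then for all $i_1,\dots,i_{2n}\in\mathbb{N}$, $$C\,u_{-2n}^{i_{2n}}\cdots u_{-2}^{i_2}u_{-1}^{i_1}\mathbf 1\ \equiv_n\ u_{-1}^{i_1}\mathbf 1*_nu_{-2n}^{i_{2n}}\cdots u_{-2}^{i_2}\mathbf 1+w',\qquad C=\binom{i_1\,\mathrm{wt}\,u+n}{n}\sum_{m=0}^n(-1)^m\binom{i_1\,\mathrm{wt}\,u}{m},$$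 where $w'$ is a linear combination of vectors $u_{-2n}^{i'_{2n}}\cdots u_{-1}^{i'_1}\mathbf 1$ for which either $i'_1+\cdots+i'_{2n}<i_1+\cdots+i_{2n}$, or $i'_1+\cdots+i'_{2n}=i_1+\cdots+i_{2n}$ and $i'_1<i_1$. Furthermore, $C=0$ if and only if $0<|i_1\,\mathrm{wt}\,u|\le n$, and $$C=(-1)^n\binom{i_1\,\mathrm{wt}\,u+n}{n}\binom{i_1\,\mathrm{wt}\,u-1}{n}\quad\text{if } i_1\,\mathrm{wt}\,u>n.$$ -/

import Mathlib

/-- A vertex algebra structure over `ℂ` on the vector space `V`. The state-field map is `Y`, with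
values in Mathlib's vertex operators, i.e. linear maps `V → V((x))`, so that the truncation
condition is built in. The Jacobi identity is given in component form (Borcherds identity). -/
structure VertexAlgebra (V : Type*) [AddCommGroup V] [Module ℂ V] where
  /-- The state-field map `u ↦ Y(u, x)`. -/
  Y : V →ₗ[ℂ] VertexOperator ℂ V
  /-- The vacuum vector. -/
  vac : V
  /-- `Y(𝟏, x) = id`. -/
  vacuum : ∀ (j : ℤ) (v : V),
    VertexOperator.ncoeff (Y vac) j v = if j = -1 then v else 0
  /-- `Y(v, x)𝟏` has no negative powers of `x` ... -/
  creation_regular : ∀ (v : V) (j : ℤ), 0 ≤ j → VertexOperator.ncoeff (Y v) j vac = 0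
  /-- ... and constant term `v`. -/
  creation : ∀ v : V, VertexOperator.ncoeff (Y v) (-1) vac = v
  /-- The Jacobi identity, coefficient by coefficient. -/
  borcherds : ∀ (u v w : V) (l m n : ℤ),
    ∑ᶠ i : ℕ, ((Ring.choose m i : ℤ) : ℂ) •
        VertexOperator.ncoeff (Y (VertexOperator.ncoeff (Y u) (l + i) v)) (m + n - i) w =
      ∑ᶠ i : ℕ, ((-1 : ℂ) ^ i * ((Ring.choose l i : ℤ) : ℂ)) •
        (VertexOperator.ncoeff (Y u) (m + l - i) (VertexOperator.ncoeff (Y v) (n + i) w) -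
          (-1 : ℂ) ^ l •
            VertexOperator.ncoeff (Y v) (n + l - i) (VertexOperator.ncoeff (Y u) (m + i) w))

namespace VertexAlgebra

variable {V : Type*} [AddCommGroup V] [Module ℂ V] (A : VertexAlgebra V)

/-- The mode `u_j` of `Y(u, x) = ∑ u_j x^{-j-1}`. -/
noncomputable def mode (u : V) (j : ℤ) : Module.End ℂ V :=
  VertexOperator.ncoeff (A.Y u) j

/-- Truncation: `u_j v = 0` for all sufficiently large `j`. -/
theorem exists_mode_eq_zero (u v : V) : ∃ N : ℤ, ∀ j : ℤ, N ≤ j → A.mode u j v = 0 := by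
  refine ⟨-HahnSeries.order ((HahnModule.of ℂ).symm (A.Y u v)), fun j hj => ?_⟩
  exact VertexOperator.ncoeff_eq_zero_of_lt_order (A.Y u) j v (by omega)

/-- `Res_x (1 + x)^a x^{-N} Y(u, x) v = ∑_{i ≥ 0} binom(a, i) u_{i-N} v`, for `a N : ℤ`, where
`(1 + x)^a` is expanded in nonnegative powers of `x`. -/
noncomputable def residue (a N : ℤ) (u v : V) : V :=
  ∑ᶠ i : ℕ, ((Ring.choose a i : ℤ) : ℂ) • A.mode u (i - N) v

/-- The sum defining `residue` is finite. -/
theorem residue_support_finite (a N : ℤ) (u v : V) :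
    (Function.support fun i : ℕ =>
      ((Ring.choose a i : ℤ) : ℂ) • A.mode u (i - N) v).Finite := by
  obtain ⟨M, hM⟩ := A.exists_mode_eq_zero u v
  refine (Set.finite_Iio (M + N).toNat).subset fun i hi => ?_
  by_contra h
  apply hi
  simp only [Set.mem_Iio, not_lt, Int.toNat_le] at h
  simp only [hM (i - N) (by omega), smul_zero]

/-- For a list of pairs `(u⁽¹⁾, k₁), …, (u⁽ʳ⁾, kᵣ)`, the vector `u⁽¹⁾_{k₁} ⋯ u⁽ʳ⁾_{kᵣ} v`. -/
noncomputable def modeProd (l : List (V × ℤ)) (v : V) : V :=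
  (l.map fun p => A.mode p.1 p.2).prod v

/-- The subalgebra `⟨S⟩` generated by `S`: the span of all `u⁽¹⁾_{k₁} ⋯ u⁽ʳ⁾_{kᵣ} 𝟏` with
`u⁽ⁱ⁾ ∈ S` and `kᵢ ∈ ℤ`. -/
noncomputable def generated (S : Set V) : Submodule ℂ V :=
  Submodule.span ℂ {x | ∃ l : List (V × ℤ), (∀ p ∈ l, p.1 ∈ S) ∧ x = A.modeProd l A.vac}

/-- `⟨S⟩^K`: the span of all `u⁽¹⁾_{k₁} ⋯ u⁽ʳ⁾_{kᵣ} 𝟏` with `u⁽ⁱ⁾ ∈ S` and `kᵢ ≤ -K`. -/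
noncomputable def positivelyGenerated (K : ℤ) (S : Set V) : Submodule ℂ V :=
  Submodule.span ℂ
    {x | ∃ l : List (V × ℤ), (∀ p ∈ l, p.1 ∈ S ∧ p.2 ≤ -K) ∧ x = A.modeProd l A.vac}

/-- `F_r(v)`, relative to `S` and `K`: the span of all `u⁽¹⁾_{-k₁} ⋯ u⁽ᵐ⁾_{-kₘ} v` with `m ≤ r`,
`u⁽ⁱ⁾ ∈ S` and `kᵢ ≥ K`. -/
noncomputable def filtration (K : ℤ) (S : Set V) (r : ℕ) (v : V) : Submodule ℂ V :=
  Submodule.span ℂ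
    {x | ∃ l : List (V × ℤ), (∀ p ∈ l, p.1 ∈ S ∧ p.2 ≤ -K) ∧ l.length ≤ r ∧ x = A.modeProd l v}

/-- The permutation property for `U` acting on `W` (with `F_r` taken relative to `S` and `K`):
for `m ≥ 1`, any `u⁽¹⁾, …, u⁽ᵐ⁾ ∈ U`, `v ∈ W` and any integers `kᵢ`, permuting the factors of
`u⁽¹⁾_{k₁} ⋯ u⁽ᵐ⁾_{kₘ} v` changes it only by an element of `F_{m-1}(v)`. -/
def PermutationProperty (K : ℤ) (S U W : Set V) : Prop :=
  ∀ l l' : List (V × ℤ), l ≠ [] → l.Perm l' → (∀ p ∈ l, p.1 ∈ U) → ∀ v ∈ W,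
    A.modeProd l v - A.modeProd l' v ∈ A.filtration K S (l.length - 1) v

/-- `u_{-t}^{i_t} u_{-t+1}^{i_{t-1}} ⋯ u_{-1}^{i_1} 𝟏`; only `i_1, …, i_t` matter. -/
noncomputable def monomial (u : V) (i : ℕ → ℕ) : ℕ → V
  | 0 => A.vac
  | t + 1 => (A.mode u (-((t : ℤ) + 1)) ^ i (t + 1)) (monomial u i t)

end VertexAlgebra

/-- A vertex operator algebra: a vertex algebra with a conformal vector `ω` of central charge `c`,
where `L(m) = ω_{m+1}`, graded by the (integral) eigenvalues of `L(0)`, with finite-dimensional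
weight spaces that vanish for sufficiently negative weights. -/
structure VertexOperatorAlgebra (V : Type*) [AddCommGroup V] [Module ℂ V] extends
    VertexAlgebra V where
  /-- The conformal vector. -/
  ω : V
  /-- The central charge. -/
  c : ℂ
  /-- The Virasoro relations. -/
  virasoro : ∀ (m n : ℤ) (v : V),
    toVertexAlgebra.mode ω (m + 1) (toVertexAlgebra.mode ω (n + 1) v) -
        toVertexAlgebra.mode ω (n + 1) (toVertexAlgebra.mode ω (m + 1) v) =
      ((m : ℂ) - n) • toVertexAlgebra.mode ω (m + n + 1) v +
        (if m + n = 0 then ((m : ℂ) ^ 3 - m) / 12 * c else 0) • v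
  /-- `Y(L(-1)u, x) = d/dx Y(u, x)`. -/
  derivative : ∀ (u : V) (j : ℤ),
    toVertexAlgebra.mode (toVertexAlgebra.mode ω 0 u) j =
      (-(j : ℂ)) • toVertexAlgebra.mode u (j - 1)
  /-- `V` is the direct sum of the eigenspaces of `L(0)` with integral eigenvalue. -/
  graded : DirectSum.IsInternal
    fun k : ℤ => Module.End.eigenspace (toVertexAlgebra.mode ω 1) (k : ℂ)
  /-- The weight spaces are finite-dimensional. -/
  finite : ∀ k : ℤ,
    FiniteDimensional ℂ (Module.End.eigenspace (toVertexAlgebra.mode ω 1) (k : ℂ))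
  /-- The weights are bounded below. -/
  bounded : ∃ N : ℤ, ∀ k : ℤ, k < N →
    Module.End.eigenspace (toVertexAlgebra.mode ω 1) (k : ℂ) = ⊥

namespace VertexOperatorAlgebra

variable {V : Type*} [AddCommGroup V] [Module ℂ V] (A : VertexOperatorAlgebra V)

/-- `L(m) = ω_{m+1}`. -/
noncomputable def L (m : ℤ) : Module.End ℂ V := A.mode A.ω (m + 1)

/-- The space of homogeneous vectors of weight `k`. -/
noncomputable def weightSpace (k : ℤ) : Submodule ℂ V :=
  Module.End.eigenspace (A.mode A.ω 1) (k : ℂ)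

/-- The projection of `V` onto its weight `k` component. -/
noncomputable def weightProj (k : ℤ) (u : V) : V :=
  ((LinearEquiv.ofBijective
    (DirectSum.coeLinearMap fun k : ℤ => Module.End.eigenspace (A.mode A.ω 1) (k : ℂ))
    A.graded).symm u) k

/-- `O_n^∘(V)`: the span of
`u ∘_n v = Res_x (1 + x)^{wt u + n} x^{-2n-2} Y(u, x) v`, `u` homogeneous, `v ∈ V`. -/
noncomputable def zhuOCirc (n : ℕ) : Submodule ℂ V :=
  Submodule.span ℂ {x | ∃ (k : ℤ) (u v : V), u ∈ A.weightSpace k ∧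
    x = A.residue (k + n) (2 * n + 2) u v}

/-- `O_n(V) = {(L(-1) + L(0))v} + O_n^∘(V)`; the quotient `V / O_n(V)` is the level `n` Zhu
algebra. -/
noncomputable def zhuO (n : ℕ) : Submodule ℂ V :=
  LinearMap.range (A.L (-1) + A.L 0) ⊔ A.zhuOCirc n

/-- `u *_n v = ∑_{m=0}^n (-1)^m binom(m+n, n) Res_x (1 + x)^{k + n} x^{-n-m-1} Y(u, x) v`, for `u`
homogeneous of weight `k`. -/
noncomputable def zhuMulHom (n : ℕ) (k : ℤ) (u v : V) : V :=
  ∑ m ∈ Finset.range (n + 1),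
    ((-1 : ℂ) ^ m * ((m + n).choose n : ℂ)) • A.residue (k + n) (n + m + 1) u v

/-- The product `u *_n v`, extended linearly from homogeneous `u` to all `u`. -/
noncomputable def zhuMul (n : ℕ) (u v : V) : V :=
  ∑ᶠ k : ℤ, A.zhuMulHom n k (A.weightProj k u) v

/-- On homogeneous `u` the product `*_n` is given by the defining formula. -/
theorem zhuMul_of_mem (n : ℕ) {k : ℤ} {u : V} (hu : u ∈ A.weightSpace k) (v : V) :
    A.zhuMul n u v = A.zhuMulHom n k u v := by
  have key : (LinearEquiv.ofBijective
      (DirectSum.coeLinearMap fun k : ℤ => Module.End.eigenspace (A.mode A.ω 1) (k : ℂ))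
      A.graded).symm u = DirectSum.lof ℂ ℤ
        (fun k : ℤ => Module.End.eigenspace (A.mode A.ω 1) (k : ℂ)) k ⟨u, hu⟩ := by
    rw [LinearEquiv.symm_apply_eq]
    exact (DirectSum.coeLinearMap_lof
      (fun k : ℤ => Module.End.eigenspace (A.mode A.ω 1) (k : ℂ)) k ⟨u, hu⟩).symm
  have h1 : A.weightProj k u = u := by
    unfold weightProj
    rw [key, DirectSum.lof_apply]
  have h2 : ∀ j, j ≠ k → A.weightProj j u = 0 := by
    intro j hj
    unfold weightProj
    rw [key, DirectSum.lof_eq_of, DirectSum.of_eq_of_ne _ _ _ hj]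
    rfl
  unfold zhuMul
  rw [finsum_eq_single _ k, h1]
  intro j hj
  rw [h2 j hj]
  simp [zhuMulHom, VertexAlgebra.residue, VertexAlgebra.mode]

end VertexOperatorAlgebra

/-- `binom(j+n, n) ∑_{m=0}^n (-1)^m binom(j, m)`, with generalized binomial coefficients. -/
noncomputable def reductionCoeff (n : ℕ) (j : ℤ) : ℤ :=
  Ring.choose (j + n) n * ∑ m ∈ Finset.range (n + 1), (-1) ^ m * Ring.choose j m

/-! Encode `u_{-a_1-1} ⋯ u_{-a_r-1} 𝟏` as the word of the list `a_1, …, a_r`. Modulo words with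
fewer letters, the permutation property makes words symmetric in their letters and makes nonnegative
modes of `u` drop a letter. By the iterate formula, `(u_{-1}^p 𝟏)_{-1-d}` then prepends `p` letters
of sum `d`: for `d = 0` only zeros (`mode_pow_neg_one_word`, `mode_pow_neg_word`).

In the product `*_n`, the `d = 0` terms add up to `C` times the full monomial, by a binomial
identity (`reductionCoeff_eq_sum`). The terms with `1 ≤ d ≤ 2n` have fewer zeros among the letters,
but may contain the forbidden letter `2n`. Since `L(-1)` raises letters one at a time, `L(-1) +
L(0)` applied to a word with `2n - 1` in place of `2n` removes that letter without creating zeros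
(`word_two_mul_cons_mem`).

Shorter words may have arbitrarily large letters. Letters above `2n` are lowered by the residues in
`O_n(V)`, the letter `2n` is again removed by `L(-1) + L(0)`, and induction leaves only letters
below `2n` (`shortWords_le`). All of this is done in an arbitrary submodule `P ⊇ O_n(V)`, finally
taken to be `O_n(V)` plus the span of the allowed monomials. -/

/-! ### Generalized binomial coefficients and the constant `C` -/

theorem Ring.succ_mul_choose_succ (a : ℤ) (i : ℕ) :
    ((i : ℤ) + 1) * Ring.choose a (i + 1) = (a - i) * Ring.choose a i := by
  have h := Ring.choose_smul_choose a (Nat.le_succ i)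
  simp only [Nat.succ_eq_add_one, Nat.choose_succ_self_right, add_tsub_cancel_left,
    Ring.choose_one_right, nsmul_eq_mul] at h
  push_cast at h
  rw [h, mul_comm]

theorem Ring.choose_succ_of_sub_one (j : ℤ) (m : ℕ) :
    Ring.choose j (m + 1) = Ring.choose (j - 1) m + Ring.choose (j - 1) (m + 1) := by
  have h := Ring.choose_succ_succ (j - 1) m
  rwa [sub_add_cancel] at h

/-- Pascal's rule makes the sum telescope. -/
theorem Ring.alternating_sum_choose (n : ℕ) (j : ℤ) :
    ∑ m ∈ Finset.range (n + 1), (-1) ^ m * Ring.choose j m =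
      (-1) ^ n * Ring.choose (j - 1) n := by
  induction n with
  | zero => simp
  | succ n ih =>
    rw [Finset.sum_range_succ, ih, Ring.choose_succ_of_sub_one j n]
    ring

theorem Ring.choose_int_eq_zero_iff (j : ℤ) (n : ℕ) :
    Ring.choose j n = 0 ↔ 0 ≤ j ∧ j < n := by
  rcases le_or_gt 0 j with hj | hj
  · lift j to ℕ using hj
    rw [Ring.choose_natCast]
    simp [Nat.choose_eq_zero_iff]
  · obtain ⟨p, rfl⟩ : ∃ p : ℕ, j = -((p : ℤ) + 1) := ⟨(-j - 1).toNat, by omega⟩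
    rw [Ring.choose_neg]
    have h : ((p : ℤ) + 1 + n - 1) = ((p + n : ℕ) : ℤ) := by push_cast; ring
    rw [h, Ring.choose_natCast]
    have : (p + n).choose n ≠ 0 := (Nat.choose_pos (by omega)).ne'
    constructor
    · intro h0
      exfalso
      rcases Int.units_eq_one_or (Int.negOnePow n) with h1 | h1 <;> simp [h1] at h0 <;> omega
    · omega

theorem reductionCoeff_eq (n : ℕ) (j : ℤ) :
    reductionCoeff n j = (-1) ^ n * Ring.choose (j + n) n * Ring.choose (j - 1) n := by
  rw [reductionCoeff, Ring.alternating_sum_choose]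
  ring

/-- In the product formula the first binomial vanishes exactly for `-n ≤ j < 0`, the second exactly
for `1 ≤ j ≤ n`. -/
theorem reductionCoeff_eq_zero_iff (n : ℕ) (j : ℤ) :
    reductionCoeff n j = 0 ↔ 0 < |j| ∧ |j| ≤ n := by
  rw [reductionCoeff_eq]
  simp only [mul_eq_zero, pow_eq_zero_iff', neg_eq_zero, one_ne_zero, false_and, false_or,
    Ring.choose_int_eq_zero_iff]
  rcases abs_cases j with ⟨h, _⟩ | ⟨h, _⟩ <;> rw [h] <;> omega

/-- This is the form in which the constant arises from the product `*_n`; the summands agree one by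
one by trinomial revision. -/
theorem reductionCoeff_eq_sum (n : ℕ) (j : ℤ) :
    reductionCoeff n j = ∑ m ∈ Finset.range (n + 1),
      (-1) ^ m * ((m + n).choose n : ℤ) * Ring.choose (j + n) (n + m) := by
  rw [reductionCoeff, Finset.mul_sum]
  refine Finset.sum_congr rfl fun m _ => ?_
  have h := Ring.choose_add_smul_choose j m n
  rw [nsmul_eq_mul] at h
  rw [add_comm n m, mul_assoc, h]
  ring

/-! ### Sums modulo a submodule -/

theorem Submodule.finsum_sub_mem {R M ι : Type*} [Ring R] [AddCommGroup M] [Module R M]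
    (P : Submodule R M) {f : ι → M} (hf : (Function.support f).Finite) (i : ι)
    (h : ∀ j, j ≠ i → f j ∈ P) : ∑ᶠ j, f j - f i ∈ P := by
  classical
  have hs : Function.support f ⊆ ↑(insert i hf.toFinset) := by
    intro j hj
    simp [hj]
  rw [finsum_eq_sum_of_support_subset f hs, ← Finset.add_sum_erase _ f (Finset.mem_insert_self i _),
    add_sub_cancel_left]
  exact P.sum_mem fun j hj => h j (Finset.ne_of_mem_erase hj)

theorem Submodule.finsum_mem {R M ι : Type*} [Ring R] [AddCommGroup M] [Module R M]
    (P : Submodule R M) {f : ι → M} (h : ∀ j, f j ∈ P) : ∑ᶠ j, f j ∈ P :=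
  finsum_induction (· ∈ P) P.zero_mem (fun _ _ => P.add_mem) h

/-- If all summands of a list sum other than those at `b` lie in `P`, the sum is congruent modulo
`P` to the contribution of `b`. -/
theorem Submodule.list_sum_sub_count_smul_mem {R M α : Type*} [Ring R] [AddCommGroup M]
    [Module R M] [DecidableEq α] (P : Submodule R M) (f : α → M) (b : α) (l : List α)
    (h : ∀ a ∈ l, a ≠ b → f a ∈ P) : (l.map f).sum - l.count b • f b ∈ P := by
  induction l with
  | nil => simp
  | cons a l ih =>
    have ih := ih fun c hc => h c (List.mem_cons_of_mem a hc)
    by_cases hab : a = b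
    · subst hab
      rw [List.map_cons, List.sum_cons, List.count_cons_self, add_smul, one_smul]
      convert ih using 1
      abel
    · rw [List.map_cons, List.sum_cons, List.count_cons_of_ne hab, add_sub_assoc]
      exact P.add_mem (h a List.mem_cons_self hab) ih

theorem Submodule.list_sum_sub_mem {R M α : Type*} [Ring R] [AddCommGroup M] [Module R M]
    (P : Submodule R M) (f g : α → M) (l : List α) (h : ∀ a ∈ l, f a - g a ∈ P) :
    (l.map f).sum - (l.map g).sum ∈ P := by
  induction l with
  | nil => simp
  | cons a l ih =>
    rw [List.map_cons, List.sum_cons, List.map_cons, List.sum_cons, add_sub_add_comm]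
    exact P.add_mem (h a List.mem_cons_self) (ih fun b hb => h b (List.mem_cons_of_mem a hb))

/-! ### Commutators, iterates and residues of modes -/

namespace VertexAlgebra

variable {V : Type*} [AddCommGroup V] [Module ℂ V] (A : VertexAlgebra V)

theorem mode_smul (c : ℂ) (u : V) (j : ℤ) : A.mode (c • u) j = c • A.mode u j := by
  simp [mode]

theorem mode_commutator_zero (u v w : V) (n : ℤ) :
    A.mode u 0 (A.mode v n w) = A.mode (A.mode u 0 v) n w + A.mode v n (A.mode u 0 w) := by
  have h := A.borcherds u v w 0 0 n
  rw [finsum_eq_single _ 0 fun i hi => by simp [Ring.choose_zero_pos ℤ (Nat.pos_of_ne_zero hi)],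
    finsum_eq_single _ 0 fun i hi => by simp [Ring.choose_zero_pos ℤ (Nat.pos_of_ne_zero hi)]] at h
  simp only [Ring.choose_zero_right, CharP.cast_eq_zero, add_zero, zero_add, sub_zero, pow_zero,
    one_mul, zpow_zero, Int.cast_one, one_smul] at h
  simp only [mode]
  rw [h]
  abel

theorem mode_commutator_one (u v w : V) (n : ℤ) :
    A.mode u 1 (A.mode v n w) = A.mode (A.mode u 0 v) (n + 1) w + A.mode (A.mode u 1 v) n w +
      A.mode v n (A.mode u 1 w) := by
  have h := A.borcherds u v w 0 1 n
  rw [finsum_eq_sum_of_support_subset (s := Finset.range 2) _ (by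
      intro i hi
      by_contra h2
      simp only [Finset.coe_range, Set.mem_Iio, not_lt] at h2
      apply hi
      have : Ring.choose (1 : ℤ) i = 0 := by
        rw [Ring.choose_int_eq_zero_iff]; omega
      simp [this]),
    finsum_eq_single _ 0 fun i hi => by simp [Ring.choose_zero_pos ℤ (Nat.pos_of_ne_zero hi)]] at h
  simp only [Finset.sum_range_succ, Finset.range_zero, Finset.sum_empty,
    Ring.choose_zero_right, Ring.choose_one_right, CharP.cast_eq_zero, add_zero, zero_add, sub_zero,
    pow_zero, one_mul, zpow_zero, Int.cast_one, one_smul, Nat.cast_one] at h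
  rw [show (1 : ℤ) + n - 1 = n by ring, add_comm 1 n] at h
  simp only [mode]
  rw [h]
  abel

theorem mode_vac (j : ℤ) (v : V) : A.mode A.vac j v = if j = -1 then v else 0 := A.vacuum j v

theorem mode_vac_of_nonneg (v : V) {j : ℤ} (hj : 0 ≤ j) : A.mode v j A.vac = 0 :=
  A.creation_regular v j hj

theorem mode_mode_neg_one_support_finite (u v w : V) (j : ℤ) :
    (Function.support fun i : ℕ =>
      A.mode u (-1 - i) (A.mode v (j + i) w) + A.mode v (j - 1 - i) (A.mode u i w)).Finite := by
  obtain ⟨M, hM⟩ := A.exists_mode_eq_zero v w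
  obtain ⟨N, hN⟩ := A.exists_mode_eq_zero u w
  refine (Set.finite_Iio (max (M - j) N).toNat).subset fun i hi => ?_
  by_contra h
  apply hi
  simp only [Set.mem_Iio, not_lt, Int.toNat_le, max_le_iff] at h
  simp only [hM (j + i) (by omega), hN i (by omega), map_zero, add_zero]

/-- The iterate formula for the normally ordered product `u_{-1} v`. -/
theorem mode_mode_neg_one (u v w : V) (j : ℤ) :
    A.mode (A.mode u (-1) v) j w =
      ∑ᶠ i : ℕ, (A.mode u (-1 - i) (A.mode v (j + i) w) +
        A.mode v (j - 1 - i) (A.mode u i w)) := by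
  have h := A.borcherds u v w (-1) 0 j
  rw [finsum_eq_single _ 0 fun i hi => by simp [Ring.choose_zero_pos ℤ (Nat.pos_of_ne_zero hi)]] at h
  simp only [Ring.choose_zero_right, CharP.cast_eq_zero, add_zero, zero_add, sub_zero,
    Int.cast_one, one_smul] at h
  simp only [mode]
  rw [h]
  refine finsum_congr fun i => ?_
  -- This sign cancels the `(-1)^i` of the Borcherds identity, so every term of the iterate formula
  -- has coefficient one.
  have hc : Ring.choose (-1 : ℤ) i = (-1) ^ i := by
    rw [Ring.choose_neg]
    have : (1 + (i : ℤ) - 1) = (i : ℤ) := by ring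
    rw [this, Ring.choose_natCast, Nat.choose_self]
    simp [Int.negOnePow_def, Units.smul_def]
  have h1 : ((-1 : ℂ) ^ i * (((-1 : ℤ) ^ i : ℤ) : ℂ)) = 1 := by
    push_cast
    rw [← mul_pow]
    simp
  rw [hc, h1, one_smul, zpow_neg_one, inv_neg, inv_one, neg_one_smul, sub_neg_eq_add]
  rfl

theorem residue_eq_sum (a N : ℤ) (u v : V) (M : ℕ) (h : ∀ j : ℤ, M - N ≤ j → A.mode u j v = 0) :
    A.residue a N u v =
      ∑ i ∈ Finset.range M, ((Ring.choose a i : ℤ) : ℂ) • A.mode u (i - N) v := by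
  refine finsum_eq_sum_of_support_subset _ fun i hi => ?_
  by_contra h2
  simp only [Finset.coe_range, Set.mem_Iio, not_lt] at h2
  exact hi (by simp only [h (i - N) (by omega), smul_zero])

/-- Integration by parts for residues: `d/dx` acts on `Y(u, x)` as `T`. -/
theorem residue_derivative (a N : ℤ) (u v u' : V)
    (hu' : ∀ j : ℤ, A.mode u' j = (-(j : ℂ)) • A.mode u (j - 1)) :
    A.residue (a + 1) N u' v =
      (N : ℂ) • A.residue a (N + 1) u v + ((N : ℂ) - a - 1) • A.residue a N u v := by
  obtain ⟨K, hK⟩ := A.exists_mode_eq_zero u v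
  -- Cutting the first two sums at `M + 1` and the last at `M` lets all three match term by term
  -- once the `i = 0` terms are split off.
  set M : ℕ := (K + N).toNat with hM
  rw [A.residue_eq_sum (a + 1) N u' v (M + 1) fun j hj => by
      rw [hu', LinearMap.smul_apply, hK (j - 1) (by push_cast at hj; omega), smul_zero],
    A.residue_eq_sum a (N + 1) u v (M + 1) fun j hj => hK j (by push_cast at hj; omega),
    A.residue_eq_sum a N u v M fun j hj => hK j (by omega),
    Finset.sum_range_succ', Finset.sum_range_succ', smul_add, Finset.smul_sum, Finset.smul_sum,
    add_right_comm, ← Finset.sum_add_distrib]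
  congr 1
  · refine Finset.sum_congr rfl fun i _ => ?_
    rw [hu', LinearMap.smul_apply]
    have e1 : ((i + 1 : ℕ) : ℤ) - N - 1 = i - N := by push_cast; ring
    have e2 : ((i + 1 : ℕ) : ℤ) - (N + 1) = i - N := by push_cast; ring
    rw [e1, e2, smul_smul, smul_smul, smul_smul, ← add_smul]
    congr 1
    have h1 := Ring.succ_mul_choose_succ a i
    rw [Ring.choose_succ_succ]
    have h2 : ((i : ℂ) + 1) * (Ring.choose a (i + 1) : ℤ) = (a - i) * (Ring.choose a i : ℤ) := by
      exact_mod_cast h1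
    push_cast
    linear_combination (-1 : ℂ) * h2
  · rw [hu', LinearMap.smul_apply]
    simp only [Ring.choose_zero_right, CharP.cast_eq_zero, zero_sub, Int.cast_one, one_smul,
      Int.cast_neg, neg_neg]
    rw [neg_add']

/-! ### Words and their filtration by length -/

/-- The vector `u_{-a_1-1} ⋯ u_{-a_r-1} 𝟏` attached to a list of natural numbers. -/
noncomputable def word (u : V) : List ℕ → V
  | [] => A.vac
  | a :: e => A.mode u (-1 - a) (word u e)

/-- The span of the words `u_{-a_1-1} ⋯ u_{-a_s-1} 𝟏` with fewer than `r` letters. -/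
noncomputable def shortWords (u : V) (r : ℕ) : Submodule ℂ V :=
  Submodule.span ℂ {x | ∃ e : List ℕ, e.length < r ∧ x = A.word u e}

variable {A} {u : V}

theorem word_append_replicate (a p : ℕ) (e : List ℕ) :
    A.word u (List.replicate p a ++ e) = (A.mode u (-1 - a) ^ p) (A.word u e) := by
  induction p with
  | zero => simp
  | succ p ih => rw [List.replicate_succ, List.cons_append, word, ih, pow_succ', Module.End.mul_apply]

theorem word_eq_modeProd (e : List ℕ) :
    A.word u e = A.modeProd (e.map fun a : ℕ => (u, -1 - (a : ℤ))) A.vac := by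
  induction e with
  | nil => simp [word, modeProd]
  | cons a e ih => simp [word, modeProd, ih]

theorem word_mem_shortWords {e : List ℕ} {r : ℕ} (h : e.length < r) :
    A.word u e ∈ A.shortWords u r :=
  Submodule.subset_span ⟨e, h, rfl⟩

theorem shortWords_mono {r s : ℕ} (h : r ≤ s) : A.shortWords u r ≤ A.shortWords u s :=
  Submodule.span_mono fun _ ⟨e, he, hx⟩ => ⟨e, he.trans_le h, hx⟩

theorem filtration_le_shortWords (r : ℕ) :
    A.filtration 1 {u} r A.vac ≤ A.shortWords u (r + 1) := by
  refine Submodule.span_le.2 ?_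
  rintro x ⟨l, hl, hr, rfl⟩
  refine Submodule.subset_span ⟨l.map fun p => (-1 - p.2).toNat, by simp; omega, ?_⟩
  rw [word_eq_modeProd, List.map_map, List.map_congr_left (g := id), List.map_id]
  intro p hp
  obtain ⟨h1, h2⟩ := hl p hp
  ext
  · exact h1.symm
  · simp only [Function.comp_apply, id_eq]
    omega

/-! ### Consequences of the permutation property -/

section Permutation

variable (hperm : A.PermutationProperty 1 {u} {u} {A.vac})
include hperm

theorem word_perm {e e' : List ℕ} (h : e.Perm e') :
    A.word u e - A.word u e' ∈ A.shortWords u e.length := by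
  rcases eq_or_ne e [] with rfl | hne
  · rw [List.nil_perm.1 h, sub_self]
    exact Submodule.zero_mem _
  · have := filtration_le_shortWords _ (hperm _ _ (by simpa using hne)
      (h.map fun a : ℕ => (u, -1 - (a : ℤ))) (by simp) A.vac rfl)
    rw [← word_eq_modeProd, ← word_eq_modeProd] at this
    rw [List.length_map, Nat.sub_add_cancel (List.length_pos_iff.2 hne)] at this
    exact this

theorem word_mem_of_perm {e e' : List ℕ} (h : e.Perm e') {P : Submodule ℂ V}
    (hP : A.shortWords u e.length ≤ P) (h' : A.word u e' ∈ P) : A.word u e ∈ P := by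
  have := P.add_mem (hP (word_perm hperm h)) h'
  rwa [sub_add_cancel] at this

/-- Moved to the far right, the mode `u_j` kills the vacuum; only the error of the permutation
remains. -/
theorem mode_nonneg_word (e : List ℕ) {j : ℤ} (hj : 0 ≤ j) :
    A.mode u j (A.word u e) ∈ A.shortWords u (e.length + 1) := by
  have hp : ((u, j) :: e.map fun a : ℕ => (u, -1 - (a : ℤ))).Perm
      ((e.map fun a : ℕ => (u, -1 - (a : ℤ))) ++ [(u, j)]) := by
    simpa using (List.perm_append_comm (l₁ := [(u, j)]))
  have := filtration_le_shortWords _ (hperm _ _ (by simp) hp (by simp) A.vac rfl)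
  have h2 : A.modeProd ((e.map fun a : ℕ => (u, -1 - (a : ℤ))) ++ [(u, j)]) A.vac = 0 := by
    simp [modeProd, A.mode_vac_of_nonneg u hj]
  rw [h2, sub_zero] at this
  rw [word_eq_modeProd]
  simpa [modeProd] using this

theorem mode_shortWords (j : ℤ) {r : ℕ} {x : V} (hx : x ∈ A.shortWords u r) :
    A.mode u j x ∈ A.shortWords u (r + 1) := by
  suffices h : A.shortWords u r ≤ (A.shortWords u (r + 1)).comap (A.mode u j) from h hx
  refine Submodule.span_le.2 ?_
  rintro x ⟨e, he, rfl⟩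
  rcases le_or_gt 0 j with hj | hj
  · exact shortWords_mono (by omega) (mode_nonneg_word hperm e hj)
  · have h := word_mem_shortWords (A := A) (u := u) (e := (-1 - j).toNat :: e) (r := r + 1)
      (by simpa using he)
    rwa [word, show -1 - ((-1 - j).toNat : ℤ) = j by omega] at h

theorem mode_pow_shortWords (p : ℕ) (j : ℤ) {r : ℕ} {x : V} (hx : x ∈ A.shortWords u r) :
    A.mode ((A.mode u (-1) ^ p) A.vac) j x ∈ A.shortWords u (r + p) := by
  induction p generalizing r x j with
  | zero =>
    rw [pow_zero, Module.End.one_apply, mode_vac]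
    split_ifs
    exacts [hx, Submodule.zero_mem _]
  | succ p ih =>
    rw [pow_succ', Module.End.mul_apply, mode_mode_neg_one]
    refine Submodule.finsum_mem _ fun i => Submodule.add_mem _ ?_ ?_
    · exact mode_shortWords hperm _ (ih _ hx)
    · rw [show r + (p + 1) = r + 1 + p by ring]
      exact ih _ (mode_shortWords hperm _ hx)

theorem mode_pow_mode_nonneg_word (p : ℕ) (j : ℤ) (i : ℕ) (e : List ℕ) :
    A.mode ((A.mode u (-1) ^ p) A.vac) j (A.mode u i (A.word u e)) ∈
      A.shortWords u (e.length + (p + 1)) := by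
  rw [show e.length + (p + 1) = e.length + 1 + p by ring]
  exact mode_pow_shortWords hperm _ _ (mode_nonneg_word hperm e (by omega))

theorem mode_pow_nonneg_word (p : ℕ) {j : ℤ} (hj : 0 ≤ j) (e : List ℕ) :
    A.mode ((A.mode u (-1) ^ p) A.vac) j (A.word u e) ∈ A.shortWords u (e.length + p) := by
  induction p generalizing j with
  | zero =>
    rw [pow_zero, Module.End.one_apply, mode_vac, if_neg (by omega)]
    exact Submodule.zero_mem _
  | succ p ih =>
    rw [pow_succ', Module.End.mul_apply, mode_mode_neg_one]
    exact Submodule.finsum_mem _ fun i => Submodule.add_mem _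
      (mode_shortWords hperm _ (ih (by omega))) (mode_pow_mode_nonneg_word hperm _ _ _ _)

theorem mode_pow_neg_one_word (p : ℕ) (e : List ℕ) :
    A.mode ((A.mode u (-1) ^ p) A.vac) (-1) (A.word u e) -
      A.word u (List.replicate p 0 ++ e) ∈ A.shortWords u (e.length + p) := by
  induction p with
  | zero =>
    rw [pow_zero, Module.End.one_apply, mode_vac, if_pos rfl]
    simp
  | succ p ih =>
    rw [pow_succ', Module.End.mul_apply, mode_mode_neg_one]
    -- For `i > 0` the inner mode `-1 + i` is nonnegative, so only `i = 0` can contribute a word of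
    -- full length.
    have h1 := Submodule.finsum_sub_mem (A.shortWords u (e.length + (p + 1)))
      (A.mode_mode_neg_one_support_finite u ((A.mode u (-1) ^ p) A.vac) (A.word u e) (-1)) 0
      fun i hi => Submodule.add_mem _
        (mode_shortWords hperm _ (mode_pow_nonneg_word hperm p (by omega) e))
        (mode_pow_mode_nonneg_word hperm _ _ _ _)
    have h2 := mode_shortWords hperm (-1) ih
    have h3 := mode_pow_mode_nonneg_word hperm p (-1 - 1 - (0 : ℕ)) 0 e
    rw [map_sub] at h2
    have h4 := Submodule.add_mem _ (Submodule.add_mem _ h1 h2) h3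
    convert h4 using 1
    rw [List.replicate_succ, List.cons_append, word]
    simp only [CharP.cast_eq_zero, sub_zero, add_zero]
    abel

/-- In the iterate formula the outer `u_{-1-i}` contributes the letter `i` and leaves `d - i` to be
shared among the other `p - 1` letters; when `i > d` the inner mode is nonnegative and the term is
short. -/
theorem mode_pow_neg_word (p d : ℕ) (e : List ℕ) :
    A.mode ((A.mode u (-1) ^ p) A.vac) (-1 - d) (A.word u e) ∈
      Submodule.span ℂ {x | ∃ l : List ℕ, l.length = p ∧ l.sum = d ∧ x = A.word u (l ++ e)} ⊔
        A.shortWords u (e.length + p) := by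
  induction p generalizing d with
  | zero =>
    rw [pow_zero, Module.End.one_apply, mode_vac]
    split_ifs with h
    · exact Submodule.mem_sup_left (Submodule.subset_span ⟨[], rfl, by simp; omega, rfl⟩)
    · exact Submodule.zero_mem _
  | succ p ih =>
    rw [pow_succ', Module.End.mul_apply, mode_mode_neg_one]
    refine Submodule.finsum_mem _ fun i => Submodule.add_mem _ ?_
      (Submodule.mem_sup_right (mode_pow_mode_nonneg_word hperm _ _ _ _))
    rcases lt_or_ge d i with hi | hi
    · exact Submodule.mem_sup_right
        (mode_shortWords hperm _ (mode_pow_nonneg_word hperm p (by omega) e))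
    · have h := ih (d - i)
      rw [show (-1 : ℤ) - ((d - i : ℕ) : ℤ) = -1 - d + i by omega] at h
      have h2 := Submodule.mem_map_of_mem (f := A.mode u (-1 - i)) h
      rw [Submodule.map_sup] at h2
      refine SetLike.le_def.1 (sup_le_sup ?_ ?_) h2
      · rw [Submodule.map_span]
        refine Submodule.span_mono ?_
        rintro _ ⟨_, ⟨l, hl, hs, rfl⟩, rfl⟩
        exact ⟨i :: l, by simp [hl], by simp [hs]; omega, by rw [List.cons_append, word]⟩
      · rintro _ ⟨x, hx, rfl⟩
        exact mode_shortWords hperm _ hx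

end Permutation

end VertexAlgebra

/-! ### Ordered monomials as words -/

namespace VertexAlgebra

/-- The list `(t-1)^{i_t} ⋯ 1^{i_2} 0^{i_1}`, whose word is `monomial u i t`. -/
def monomialList (i : ℕ → ℕ) : ℕ → List ℕ
  | 0 => []
  | t + 1 => List.replicate (i (t + 1)) t ++ monomialList i t

theorem count_monomialList (i : ℕ → ℕ) (t a : ℕ) :
    (monomialList i t).count a = if a < t then i (a + 1) else 0 := by
  induction t with
  | zero => simp [monomialList]
  | succ t ih =>
    rw [monomialList, List.count_append, ih, List.count_replicate]
    rcases lt_trichotomy a t with h | rfl | h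
    · simp [h, h.ne', h.trans (Nat.lt_succ_self t)]
    · simp
    · simp [h.ne, h.not_gt, show ¬ a < t + 1 by omega]

theorem length_monomialList (i : ℕ → ℕ) (t : ℕ) :
    (monomialList i t).length = ∑ j ∈ Finset.Icc 1 t, i j := by
  induction t with
  | zero => simp [monomialList]
  | succ t ih =>
    rw [monomialList, List.length_append, ih, List.length_replicate,
      Finset.sum_Icc_succ_top (by omega), add_comm]

theorem perm_monomialList {e : List ℕ} {t : ℕ} (h : ∀ a ∈ e, a < t) :
    e.Perm (monomialList (fun j => e.count (j - 1)) t) := by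
  refine List.perm_iff_count.2 fun a => ?_
  rw [count_monomialList, add_tsub_cancel_right]
  split_ifs with ha
  · rfl
  · exact List.count_eq_zero.2 fun hm => ha (h a hm)

theorem monomialList_perm_update {t : ℕ} (ht : 0 < t) (i : ℕ → ℕ) :
    (monomialList i t).Perm
      (List.replicate (i 1) 0 ++ monomialList (Function.update i 1 0) t) := by
  refine List.perm_iff_count.2 fun a => ?_
  rw [List.count_append, count_monomialList, count_monomialList, List.count_replicate]
  rcases Nat.eq_zero_or_pos a with rfl | ha
  · simp [ht]
  · simp [ha.ne, ha.ne']

variable {V : Type*} [AddCommGroup V] [Module ℂ V] {A : VertexAlgebra V} {u : V}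

theorem word_monomialList (i : ℕ → ℕ) (t : ℕ) :
    A.word u (monomialList i t) = A.monomial u i t := by
  induction t with
  | zero => rfl
  | succ t ih =>
    rw [monomialList, word_append_replicate, ih, monomial, neg_add_rev, ← sub_eq_add_neg]

end VertexAlgebra

/-! ### Weights, `L(-1)`, and higher residues in `O_n(V)` -/

namespace VertexOperatorAlgebra

open VertexAlgebra

variable {V : Type*} [AddCommGroup V] [Module ℂ V] {A : VertexOperatorAlgebra V}

theorem mem_weightSpace {k : ℤ} {v : V} : v ∈ A.weightSpace k ↔ A.L 0 v = (k : ℂ) • v := by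
  rw [weightSpace, Module.End.mem_eigenspace_iff]
  rfl

theorem L_neg_one_vac : A.L (-1) A.vac = 0 := A.mode_vac_of_nonneg _ (by norm_num)

theorem L_neg_one_mode (u v : V) (j : ℤ) :
    A.L (-1) (A.mode u j v) = A.mode u j (A.L (-1) v) - (j : ℂ) • A.mode u (j - 1) v := by
  have h := A.mode_commutator_zero A.ω u v j
  rw [A.derivative] at h
  simp only [L, neg_add_cancel]
  rw [h, LinearMap.smul_apply, neg_smul]
  abel

theorem mode_mem_weightSpace {k l : ℤ} {u v : V} (hu : u ∈ A.weightSpace k)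
    (hv : v ∈ A.weightSpace l) (j : ℤ) : A.mode u j v ∈ A.weightSpace (k + l - j - 1) := by
  rw [mem_weightSpace] at *
  have h := A.mode_commutator_one A.ω u v j
  simp only [L, zero_add] at *
  rw [h, hu, hv, A.derivative, mode_smul, map_smul]
  simp only [LinearMap.smul_apply, add_sub_cancel_right]
  rw [← add_smul, ← add_smul]
  push_cast
  congr 1
  ring

theorem vac_mem_weightSpace : A.vac ∈ A.weightSpace 0 := by
  rw [mem_weightSpace, L, A.mode_vac_of_nonneg _ (by norm_num)]
  simp

theorem L_neg_one_mem_weightSpace {k : ℤ} {v : V} (hv : v ∈ A.weightSpace k) :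
    A.L (-1) v ∈ A.weightSpace (k + 1) := by
  have hω : ∀ w l, w ∈ A.weightSpace l → A.L 0 (A.L (-1) w) - A.L (-1) (A.L 0 w) = A.L (-1) w := by
    intro w l _
    have := A.virasoro 0 (-1) w
    simpa [L] using this
  have h := hω v k hv
  rw [mem_weightSpace] at *
  rw [hv, map_smul, sub_eq_iff_eq_add] at h
  rw [h]
  push_cast
  rw [add_smul, one_smul, add_comm]

theorem mode_neg_one_pow_mem_weightSpace {k : ℤ} {u : V} (hu : u ∈ A.weightSpace k) (p : ℕ) :
    (A.mode u (-1) ^ p) A.vac ∈ A.weightSpace (p * k) := by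
  induction p with
  | zero => simpa using vac_mem_weightSpace
  | succ p ih =>
    rw [pow_succ', Module.End.mul_apply]
    convert mode_mem_weightSpace hu ih (-1) using 2
    push_cast
    ring

theorem exists_word_mem_weightSpace {k : ℤ} {u : V} (hu : u ∈ A.weightSpace k) (e : List ℕ) :
    ∃ l : ℤ, A.word u e ∈ A.weightSpace l := by
  induction e with
  | nil => exact ⟨0, vac_mem_weightSpace⟩
  | cons a e ih =>
    obtain ⟨l, hl⟩ := ih
    exact ⟨_, mode_mem_weightSpace hu hl _⟩

/-- Induction on `r`: replacing `u` by `L(-1)u`, of weight one higher, and integrating by parts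
expresses the residue with one more pole order through known ones, with nonzero factor `2n + 2 + r`.
-/
theorem residue_mem_zhuO (n r : ℕ) {k : ℤ} {u : V} (hu : u ∈ A.weightSpace k) (v : V) :
    A.residue (k + n) (2 * n + 2 + r) u v ∈ A.zhuO n := by
  induction r generalizing k u with
  | zero =>
    refine Submodule.mem_sup_right (Submodule.subset_span ⟨k, u, v, hu, ?_⟩)
    simp
  | succ r ih =>
    have h1 : A.residue (k + 1 + n) (2 * n + 2 + r) (A.mode A.ω 0 u) v ∈ A.zhuO n := by
      exact_mod_cast ih (L_neg_one_mem_weightSpace hu)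
    rw [add_right_comm, A.residue_derivative _ _ u v _ (A.derivative u)] at h1
    have h2 := (Submodule.add_mem_iff_left _ (Submodule.smul_mem _ _ (ih hu))).1 h1
    rw [Submodule.smul_mem_iff _ (by exact_mod_cast (by omega : 2 * n + 2 + r ≠ 0))] at h2
    rwa [show (2 * n + 2 + (r + 1 : ℕ) : ℤ) = 2 * n + 2 + r + 1 by push_cast; ring]

/-! ### Reduction of words modulo `O_n(V)` -/

section Reduction

variable {n : ℕ} {u : V} {k : ℤ} {P : Submodule ℂ V}
  (hu : u ∈ A.weightSpace k) (hperm : A.PermutationProperty 1 {u} {u} {A.vac})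

include hperm in
/-- `L(-1)` acts on words, up to shorter words, as a derivation raising the letters. -/
theorem L_neg_one_word (e : List ℕ) :
    A.L (-1) (A.word u e) -
      (e.map fun a : ℕ => ((a : ℂ) + 1) • A.word u ((a + 1) :: e.erase a)).sum ∈
      A.shortWords u e.length := by
  induction e with
  | nil => simp [word, L_neg_one_vac]
  | cons a e ih =>
    have h1 := mode_shortWords hperm (-1 - a) ih
    have h2 : A.mode u (-1 - a)
        (e.map fun b : ℕ => ((b : ℂ) + 1) • A.word u ((b + 1) :: e.erase b)).sum -
        (e.map fun b : ℕ => ((b : ℂ) + 1) • A.word u ((b + 1) :: (a :: e).erase b)).sum ∈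
        A.shortWords u (e.length + 1) := by
      rw [map_list_sum, List.map_map]
      refine Submodule.list_sum_sub_mem _ _ _ _ fun b hb => ?_
      simp only [Function.comp_apply, map_smul, ← smul_sub]
      refine Submodule.smul_mem _ _ ?_
      have hp : (a :: (b + 1) :: e.erase b).Perm ((b + 1) :: (a :: e).erase b) :=
        (List.Perm.swap _ _ _).trans (List.Perm.cons _ (by
          rcases eq_or_ne a b with rfl | hab
          · rw [List.erase_cons_head]
            exact (List.perm_cons_erase hb).symm
          · rw [List.erase_cons_tail (by simpa using hab)]))
      have h3 := word_perm hperm hp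
      rw [word] at h3
      have h4 : (a :: (b + 1) :: e.erase b).length = e.length + 1 := by
        rw [List.length_cons, List.length_cons, List.length_erase_add_one hb]
      rwa [h4] at h3
    have h3 := Submodule.add_mem _ h1 h2
    rw [List.length_cons]
    convert h3 using 1
    have hw : A.word u ((a + 1) :: e) = A.mode u (-1 - (a : ℤ) - 1) (A.word u e) := by
      rw [word]
      push_cast
      rw [sub_sub]
    rw [word, L_neg_one_mode, List.map_cons, List.sum_cons, List.erase_cons_head, map_sub, hw]
    push_cast
    module

include hu hperm in
/-- Modulo `L(-1) + L(0)`, a letter `2n` can be traded against the letters of a word that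
contains `2n - 1`. -/
theorem word_cons_mem_of_bumps (hn : 1 ≤ n) (hO : A.zhuO n ≤ P) {e : List ℕ}
    (hs : A.shortWords u (e.length + 1) ≤ P) (hy : A.word u ((2 * n - 1) :: e) ∈ P)
    (hb : ∀ a ∈ e, a ≠ 2 * n - 1 →
      A.word u ((a + 1) :: ((2 * n - 1) :: e).erase a) ∈ P) :
    A.word u (2 * n :: e) ∈ P := by
  set e' := (2 * n - 1) :: e with he'
  obtain ⟨l, hl⟩ := exists_word_mem_weightSpace hu e'
  -- The word is homogeneous, so `L(0)` only rescales it and stays in `P`.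
  have h0 : A.L (-1) (A.word u e') ∈ P := by
    have h1 : A.L (-1) (A.word u e') + A.L 0 (A.word u e') ∈ P :=
      hO (Submodule.mem_sup_left ⟨A.word u e', rfl⟩)
    rw [mem_weightSpace.1 hl] at h1
    exact (Submodule.add_mem_iff_left _ (P.smul_mem _ hy)).1 h1
  have h1 := P.sub_mem h0 (hs (L_neg_one_word hperm e'))
  rw [sub_sub_cancel] at h1
  have h2 := P.list_sum_sub_count_smul_mem
    (fun a : ℕ => ((a : ℂ) + 1) • A.word u ((a + 1) :: e'.erase a)) (2 * n - 1) e'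
    fun a ha hne => P.smul_mem _ (hb a (List.mem_of_ne_of_mem hne ha) hne)
  have h3 := P.sub_mem h1 h2
  -- The surviving coefficient is `2n` times the multiplicity of `2n - 1`, which is nonzero.
  rw [sub_sub_cancel, ← Nat.cast_smul_eq_nsmul ℂ, smul_smul, Submodule.smul_mem_iff] at h3
  · rwa [he', List.erase_cons_head, Nat.sub_add_cancel (by omega)] at h3
  · refine mul_ne_zero ?_ (by exact_mod_cast Nat.succ_ne_zero (2 * n - 1))
    rw [he', List.count_cons_self]
    exact_mod_cast Nat.succ_ne_zero (e.count (2 * n - 1))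

include hu in
/-- Modulo `O_n(V)`, a leading letter `a ≥ 2n + 1` can be lowered. -/
theorem word_cons_mem_of_lower (hO : A.zhuO n ≤ P) {a : ℕ} (ha : 2 * n + 1 ≤ a) {e : List ℕ}
    (hl : ∀ b < a, A.word u (b :: e) ∈ P)
    (hnn : ∀ j : ℤ, 0 ≤ j → A.mode u j (A.word u e) ∈ P) : A.word u (a :: e) ∈ P := by
  have h1 := hO (residue_mem_zhuO n (a - (2 * n + 1)) hu (A.word u e))
  -- The pole order is `a + 1`, so term `0` is the letter `a` with coefficient one, terms `0 < i ≤
  -- a` carry the letter `a - i`, and later terms are nonnegative modes.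
  have h2 := P.finsum_sub_mem (A.residue_support_finite (k + n) (2 * n + 2 + (a - (2 * n + 1) : ℕ))
    u (A.word u e)) 0 fun i hi => by
      refine P.smul_mem _ ?_
      rcases lt_or_ge a i with h | h
      · exact hnn _ (by omega)
      · have := hl (a - i) (by omega)
        rw [word] at this
        convert this using 3
        omega
  have h3 := P.sub_mem h1 h2
  rw [residue, sub_sub_cancel, Ring.choose_zero_right, Int.cast_one, one_smul] at h3
  rw [word]
  convert h3 using 3
  omega

include hu hperm in
-- Lexicographic induction on the letter sum and then the number of letters `2n`. Lowering a letter
-- above `2n` decreases the sum; trading a letter `2n` keeps the sum and either decreases their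
-- number or produces a letter `2n + 1`.
theorem word_mem_of_small (hn : 1 ≤ n) (hO : A.zhuO n ≤ P) {r : ℕ} (hs : A.shortWords u r ≤ P)
    (hP : ∀ e : List ℕ, e.length = r → (∀ a ∈ e, a < 2 * n) → A.word u e ∈ P) :
    ∀ (d b : ℕ) (e : List ℕ), e.length = r → e.sum = d → e.count (2 * n) = b → A.word u e ∈ P := by
  intro d
  induction d using Nat.strong_induction_on with
  | _ d ihd =>
  have hbig : ∀ e : List ℕ, e.length = r → e.sum = d → (∃ a ∈ e, 2 * n + 1 ≤ a) →
      A.word u e ∈ P := by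
    rintro e rfl rfl ⟨a, ha, han⟩
    have hp := List.perm_cons_erase ha
    have hlen := List.length_erase_add_one ha
    have hsum := hp.sum_eq
    rw [List.sum_cons] at hsum
    refine word_mem_of_perm hperm hp hs (word_cons_mem_of_lower hu hO han (fun b hb => ?_)
      fun j hj => hs ?_)
    · exact ihd (b + (e.erase a).sum) (by omega) _ _ (by simpa using hlen) (by simp) rfl
    · have := mode_nonneg_word hperm (e.erase a) hj
      rwa [hlen] at this
  intro b
  induction b using Nat.strong_induction_on with
  | _ b ihb =>
  intro e hlen hsum hcount
  by_cases hB : ∃ a ∈ e, 2 * n + 1 ≤ a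
  · exact hbig e hlen hsum hB
  push Not at hB
  by_cases h2 : 2 * n ∈ e
  · have hp := List.perm_cons_erase h2
    set e₁ := e.erase (2 * n) with he₁
    have hlen1 : e₁.length + 1 = r := by rw [← hlen, hp.length_eq, List.length_cons]
    have hsum1 : 2 * n + e₁.sum = d := by rw [← hsum, hp.sum_eq, List.sum_cons]
    have hcount1 : e₁.count (2 * n) + 1 = b := by
      rw [← hcount, hp.count_eq, List.count_cons_self]
    refine word_mem_of_perm hperm hp (by rwa [hlen])
      (word_cons_mem_of_bumps hu hperm hn hO (by rwa [hlen1]) ?_ ?_)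
    · exact ihd (2 * n - 1 + e₁.sum) (by omega) _ _ (by simpa using hlen1) (by simp) rfl
    · intro a ha hne
      have hp2 := List.perm_cons_erase (List.mem_cons_of_mem (2 * n - 1) ha)
      set e₂ := ((2 * n - 1) :: e₁).erase a with he₂
      have hlen2 : e₁.length + 1 = e₂.length + 1 := by simpa using hp2.length_eq
      have hsum2 : 2 * n - 1 + e₁.sum = a + e₂.sum := by simpa using hp2.sum_eq
      have hcount2 : e₁.count (2 * n) = (a :: e₂).count (2 * n) := by
        rw [← hp2.count_eq, List.count_cons_of_ne (by omega)]
      rcases eq_or_ne a (2 * n) with rfl | hne2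
      -- Raising another letter `2n` gives `2n + 1`, a case already settled for this same sum.
      · exact hbig _ (by simp; omega) (by simp; omega) ⟨2 * n + 1, by simp, le_rfl⟩
      · rw [List.count_cons_of_ne hne2] at hcount2
        refine ihb (e₂.count (2 * n)) (by omega) _ (by simp; omega) (by simp; omega) ?_
        rw [List.count_cons_of_ne (by omega)]
  · refine hP e hlen fun a ha => ?_
    have := hB a ha
    have : a ≠ 2 * n := fun h => h2 (h ▸ ha)
    omega

include hu hperm in
/-- Words with fewer than `r` letters reduce to words in the letters `0, …, 2n - 1`. -/
theorem shortWords_le (hn : 1 ≤ n) (hO : A.zhuO n ≤ P) (r : ℕ)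
    (hP : ∀ e : List ℕ, e.length < r → (∀ a ∈ e, a < 2 * n) → A.shortWords u e.length ≤ P →
      A.word u e ∈ P) : A.shortWords u r ≤ P := by
  induction r with
  | zero => exact Submodule.span_le.2 fun x ⟨e, he, _⟩ => absurd he (Nat.not_lt_zero _)
  | succ r ih =>
    have ih := ih fun e he => hP e (by omega)
    refine Submodule.span_le.2 ?_
    rintro x ⟨e, he, rfl⟩
    rcases (Nat.lt_succ_iff.1 he).lt_or_eq with h | h
    · exact ih (word_mem_shortWords h)
    · exact word_mem_of_small hu hperm hn hO ih
        (fun e' he' ha => hP e' (by omega) ha (by rwa [he'])) _ _ e h rfl rfl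

include hu hperm in
-- Here the number of zeros must be controlled: neither inserting `2n - 1 > 0` nor raising a letter
-- creates a zero, and raising a letter below `2n - 1` keeps it below `2n`.
theorem word_two_mul_cons_mem (hn : 1 ≤ n) (hO : A.zhuO n ≤ P) {e : List ℕ} {z : ℕ}
    (hs : A.shortWords u (e.length + 1) ≤ P) (hz : e.count 0 < z) (he : ∀ a ∈ e, a < 2 * n)
    (hP : ∀ e' : List ℕ, e'.length = e.length + 1 → (∀ a ∈ e', a < 2 * n) → e'.count 0 < z →
      A.word u e' ∈ P) : A.word u (2 * n :: e) ∈ P := by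
  have hm : ∀ a ∈ (2 * n - 1) :: e, a < 2 * n := by
    intro a ha
    rcases List.mem_cons.1 ha with rfl | ha
    exacts [by omega, he a ha]
  have hc : ((2 * n - 1) :: e).count 0 < z := by rwa [List.count_cons_of_ne (by omega)]
  refine word_cons_mem_of_bumps hu hperm hn hO hs (hP _ (by simp) hm hc) fun a ha hne => ?_
  have hae := List.mem_cons_of_mem (2 * n - 1) ha
  refine hP _ ?_ ?_ ?_
  · have := List.length_erase_add_one hae
    rw [List.length_cons, this, List.length_cons]
  · intro b hb
    rcases List.mem_cons.1 hb with rfl | hb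
    · have := he a ha
      omega
    · exact hm b (List.mem_of_mem_erase hb)
  · rw [List.count_cons_of_ne (by omega)]
    exact ((List.erase_sublist).count_le 0).trans_lt hc

include hu hperm in
-- As the sum is at most `2n`, a letter `2n` in `l` forces its other letters to be zero. Otherwise
-- all letters are below `2n`, and the positive sum excludes that all of `l` is zero.
theorem word_append_mem (hn : 1 ≤ n) (hO : A.zhuO n ≤ P) {l e : List ℕ}
    (hs : A.shortWords u (e.length + l.length) ≤ P) (hl : 0 < l.sum) (hl2 : l.sum ≤ 2 * n)
    (he : ∀ a ∈ e, a < 2 * n) (he0 : e.count 0 = 0)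
    (hP : ∀ e' : List ℕ, e'.length = e.length + l.length → (∀ a ∈ e', a < 2 * n) →
      e'.count 0 < l.length → A.word u e' ∈ P) : A.word u (l ++ e) ∈ P := by
  by_cases hb : 2 * n ∈ l
  · have hp := List.perm_cons_erase hb
    have hsum := hp.sum_eq
    have hlen := List.length_erase_add_one hb
    rw [List.sum_cons] at hsum
    have h0 : ∀ a ∈ l.erase (2 * n), a = 0 := List.sum_eq_zero_iff.1 (by omega)
    have hlen2 : (l.erase (2 * n) ++ e).length + 1 = e.length + l.length := by
      rw [List.length_append]
      omega
    refine word_mem_of_perm hperm (hp.append_right e) (by rwa [List.length_append, add_comm]) ?_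
    refine word_two_mul_cons_mem hu hperm hn hO (e := l.erase (2 * n) ++ e) (z := l.length) (by rwa [hlen2]) ?_ ?_
      (by rwa [hlen2])
    · rw [List.count_append, he0, ← hlen]
      exact Nat.lt_succ_of_le List.count_le_length
    · intro a ha
      rcases List.mem_append.1 ha with ha | ha
      · rw [h0 a ha]
        omega
      · exact he a ha
  · refine hP _ (by rw [List.length_append, add_comm]) ?_ ?_
    · intro a ha
      rcases List.mem_append.1 ha with ha | ha
      · have h1 := List.le_sum_of_mem ha
        have h2 : a ≠ 2 * n := fun h => hb (h ▸ ha)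
        omega
      · exact he a ha
    · rw [List.count_append, he0, add_zero]
      refine lt_of_le_of_ne List.count_le_length fun h => hl.ne' ?_
      exact List.sum_eq_zero fun a ha => (List.count_eq_length.1 h a ha).symm

include hu hperm in
theorem residue_pow_word_sub_mem (hn : 1 ≤ n) (hO : A.zhuO n ≤ P) {p m : ℕ} (hm : m ≤ n)
    {e : List ℕ} (hs : A.shortWords u (e.length + p) ≤ P)
    (he : ∀ a ∈ e, a < 2 * n) (he0 : e.count 0 = 0)
    (hP : ∀ e' : List ℕ, e'.length = e.length + p → (∀ a ∈ e', a < 2 * n) →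
      e'.count 0 < p → A.word u e' ∈ P) (K : ℤ) :
    A.residue K (n + m + 1) ((A.mode u (-1) ^ p) A.vac) (A.word u e) -
      ((Ring.choose K (n + m) : ℤ) : ℂ) • A.word u (List.replicate p 0 ++ e) ∈ P := by
  -- Index `n + m` is the mode `-1`, the source of the leading word. Smaller indices give letter
  -- sums between `1` and `n + m ≤ 2n`; larger ones give short words.
  have h1 := P.finsum_sub_mem (A.residue_support_finite K (n + m + 1)
    ((A.mode u (-1) ^ p) A.vac) (A.word u e)) (n + m) fun i hi => by
      refine P.smul_mem _ ?_
      rcases lt_or_gt_of_ne hi with h | h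
      · have h2 := mode_pow_neg_word hperm p (n + m - i) e
        rw [show (-1 : ℤ) - (n + m - i : ℕ) = i - (n + m + 1) by omega] at h2
        refine (sup_le (Submodule.span_le.2 ?_) hs : _ ≤ P) h2
        rintro x ⟨l, rfl, hl, rfl⟩
        exact word_append_mem hu hperm hn hO hs (by omega) (by omega) he he0 hP
      · exact hs (mode_pow_nonneg_word hperm p (by omega) e)
  have h2 := P.smul_mem ((Ring.choose K (n + m) : ℤ) : ℂ) (hs (mode_pow_neg_one_word hperm p e))
  rw [show (((n + m : ℕ) : ℤ) - (n + m + 1)) = -1 by push_cast; ring] at h1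
  have h3 := P.add_mem h1 h2
  rw [smul_sub, sub_add_sub_cancel] at h3
  exact h3

include hu hperm in
theorem zhuMul_pow_word_sub_mem (hn : 1 ≤ n) (hO : A.zhuO n ≤ P) {p : ℕ}
    {e : List ℕ} (hs : A.shortWords u (e.length + p) ≤ P)
    (he : ∀ a ∈ e, a < 2 * n) (he0 : e.count 0 = 0)
    (hP : ∀ e' : List ℕ, e'.length = e.length + p → (∀ a ∈ e', a < 2 * n) →
      e'.count 0 < p → A.word u e' ∈ P) :
    A.zhuMul n ((A.mode u (-1) ^ p) A.vac) (A.word u e) -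
      (reductionCoeff n (p * k) : ℂ) • A.word u (List.replicate p 0 ++ e) ∈ P := by
  rw [A.zhuMul_of_mem n (mode_neg_one_pow_mem_weightSpace hu p), zhuMulHom, reductionCoeff_eq_sum]
  push_cast
  rw [Finset.sum_smul, ← Finset.sum_sub_distrib]
  refine P.sum_mem fun m hm => ?_
  rw [mul_smul (_ * _), ← smul_sub]
  exact P.smul_mem _ (residue_pow_word_sub_mem hu hperm hn hO
    (Nat.lt_succ_iff.1 (Finset.mem_range.1 hm)) hs he he0 hP _)

end Reduction

end VertexOperatorAlgebra


/-! ### The reduction formula -/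

theorem mainTheorem6 {V : Type*} [AddCommGroup V] [Module ℂ V] (A : VertexOperatorAlgebra V)
    (n : ℕ) (hn : 1 ≤ n) (u : V) (k : ℤ) (hu : u ∈ A.weightSpace k) (hk : -(n : ℤ) ≤ k)
    (hgen : A.generated {u} = A.positivelyGenerated 1 {u})
    (hperm : A.PermutationProperty 1 {u} {u} {A.vac})
    (i : ℕ → ℕ) :
    (∃ w' ∈ Submodule.span ℂ {x : V | ∃ i' : ℕ → ℕ,
        (∑ j ∈ Finset.Icc 1 (2 * n), i' j < ∑ j ∈ Finset.Icc 1 (2 * n), i j ∨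
          (∑ j ∈ Finset.Icc 1 (2 * n), i' j = ∑ j ∈ Finset.Icc 1 (2 * n), i j ∧ i' 1 < i 1)) ∧
        x = A.monomial u i' (2 * n)},
      SModEq (A.zhuO n)
        ((reductionCoeff n (i 1 * k) : ℂ) • A.monomial u i (2 * n))
        (A.zhuMul n ((A.mode u (-1) ^ i 1) A.vac)
          (A.monomial u (Function.update i 1 0) (2 * n)) + w')) ∧
    (reductionCoeff n (i 1 * k) = 0 ↔ 0 < |(i 1 : ℤ) * k| ∧ |(i 1 : ℤ) * k| ≤ n) ∧
    ((n : ℤ) < i 1 * k →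
      reductionCoeff n (i 1 * k) =
        (-1) ^ n * Ring.choose ((i 1 : ℤ) * k + n) n * Ring.choose ((i 1 : ℤ) * k - 1) n) := by
  refine ⟨?_, reductionCoeff_eq_zero_iff n _, fun _ => reductionCoeff_eq n _⟩
  set S := Submodule.span ℂ {x : V | ∃ i' : ℕ → ℕ,
    (∑ j ∈ Finset.Icc 1 (2 * n), i' j < ∑ j ∈ Finset.Icc 1 (2 * n), i j ∨
      (∑ j ∈ Finset.Icc 1 (2 * n), i' j = ∑ j ∈ Finset.Icc 1 (2 * n), i j ∧ i' 1 < i 1)) ∧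
    x = A.monomial u i' (2 * n)} with hS
  have hO : A.zhuO n ≤ S ⊔ A.zhuO n := le_sup_right
  set e := VertexAlgebra.monomialList (Function.update i 1 0) (2 * n) with he
  have hp := VertexAlgebra.monomialList_perm_update (by omega : 0 < 2 * n) i
  have hlen : e.length + i 1 = ∑ j ∈ Finset.Icc 1 (2 * n), i j := by
    rw [← VertexAlgebra.length_monomialList, hp.length_eq, List.length_append,
      List.length_replicate, add_comm]
  -- Sorting a word into a monomial costs shorter words, so these must already be known to lie in
  -- the submodule.
  have hword : ∀ e' : List ℕ, (∀ a ∈ e', a < 2 * n) →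
      A.shortWords u e'.length ≤ S ⊔ A.zhuO n →
      (e'.length < e.length + i 1 ∨ e'.length = e.length + i 1 ∧ e'.count 0 < i 1) →
      A.word u e' ∈ S ⊔ A.zhuO n := by
    intro e' ha hs h
    have hp' := VertexAlgebra.perm_monomialList ha
    refine VertexAlgebra.word_mem_of_perm hperm hp' hs (Submodule.mem_sup_left
      (Submodule.subset_span ⟨_, ?_, VertexAlgebra.word_monomialList _ _⟩))
    rw [← VertexAlgebra.length_monomialList, ← hp'.length_eq, ← hlen]
    exact h
  have hs : A.shortWords u (e.length + i 1) ≤ S ⊔ A.zhuO n :=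
    VertexOperatorAlgebra.shortWords_le hu hperm hn hO _ fun e' h1 h2 h3 =>
      hword e' h2 h3 (Or.inl h1)
  have he1 : ∀ a ∈ e, a < 2 * n := by
    intro a ha
    by_contra h
    refine List.count_eq_zero.1 ?_ ha
    rw [VertexAlgebra.count_monomialList, if_neg h]
  have he0 : e.count 0 = 0 := by simp [he, VertexAlgebra.count_monomialList]
  have h1 := VertexOperatorAlgebra.zhuMul_pow_word_sub_mem hu hperm hn hO hs he1 he0
    fun e' h1 h2 h3 => hword e' h2 (by rwa [h1]) (Or.inr ⟨h1, h3⟩)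
  have h2 := VertexAlgebra.word_perm hperm hp
  rw [VertexAlgebra.length_monomialList, ← hlen] at h2
  have h3 := Submodule.sub_mem _ (Submodule.smul_mem _ (reductionCoeff n (i 1 * k) : ℂ) (hs h2)) h1
  rw [smul_sub, ← he, ← neg_sub (_ • _) (A.zhuMul _ _ _), sub_neg_eq_add, sub_add_sub_cancel, VertexAlgebra.word_monomialList,
    VertexAlgebra.word_monomialList] at h3
  obtain ⟨w, hw, o, ho, hwo⟩ := Submodule.mem_sup.1 h3
  refine ⟨w, hw, SModEq.sub_mem.2 ?_⟩
  rwa [← sub_sub, ← hwo, add_sub_cancel_left]
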